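/- Let $\lambda$ be a regular cardinal and let $\mathcal V=(\mathcal V_0,\otimes,I)$ be a complete and cocomplete symmetric monoidal closed category which is locally $\lambda$-presentable as a closed category: $\mathcal V_0$ is locally $\lambda$-presentable, $I$ is $\lambda$-presentable, and the tensor product of two $\lambda$-presentable objects is $\lambda$-presentable. Let $(\mathcal E,\mathcal M)$ be an (orthogonal) factorization system on $\mathcal V_0$. Let $\mathcal K$ be a $\mathcal V$-category with underlying ordinary category $\mathcal K_0$. An object $A$ of $\mathcal K$ is *$\lambda$-presentable in the enriched sense* if $\mathcal K(A,-)\colon\mathcal K\to\mathcal V$ preserves conical $\lambda$-filtered colimits. $\mathcal K$ is *locally $\lambda$-presentable as a $\mathcal V$-category* if it has all small conical colimits and all copowers, its $\lambda$-presentable objects form an essentially small class, and each object is a conical $\lambda$-filtered colimit of $\lambda$-presentable objects. Given $f\colon K\to L$ and $g\colon A\to B$ in $\mathcal K_0$, let $\mathcal K(B,L)\xrightarrow{\,e\,}\mathcal P(g,L)\xrightarrow{\,m\,}\mathcal K(A,L)$ be the $(\mathcal E,\mathcal M)$-factorization of $\mathcal K(g,L)$, let $\mathcal P(g,f)$ be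 the pullback of $m$ along $\mathcal K(A,f)\colon\mathcal K(A,K)\to\mathcal K(A,L)$, and let $r\colon\mathcal K(B,K)\to\mathcal P(g,f)$ be the map induced by $\mathcal K(g,K)$ and $e\circ\mathcal K(B,f)$. The morphism $f$ is *$(\lambda,\mathcal E)$-pure* if $r\in\mathcal E$ for every $g\colon A\to B$ with $A$ and $B$ $\lambda$-presentable in the enriched sense. The morphism $f$ is *ordinary $\lambda$-pure* if, for every $g\colon A\to B$ in $\mathcal K_0$ with $A$ and $B$ $\lambda$-presentable in $\mathcal K_0$ and all $u\colon A\to K$, $v\colon B\to L$ with $fu=vg$, there is $t\colon B\to K$ with $tg=u$. **Statement.** Suppose that $(\mathcal E,\mathcal M)$ is proper (each morphism in $\mathcal E$ is an epimorphism and each morphism in $\mathcal M$ is a monomorphism) and that $\mathcal M$ is closed under $\lambda$-filtered colimits in the arrow category $\mathcal V^{\to}$. Then every ordinary $\lambda$-pure morphism in a locally $\lambda$-presentable $\mathcal V$-category $\mathcal K$ is $(\lambda,\mathcal E)$-pure. -/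

import Mathlib

open CategoryTheory MonoidalCategory Limits

universe w u u'

namespace EnrichedPurity

section FactorizationSystems

variable {C : Type u} [Category.{w} C]

/-- `e` is orthogonal to `m`: every commutative square from `e` to `m` has a unique diagonal. -/
def Orthogonal {X Y Z W : C} (e : X ⟶ Y) (m : Z ⟶ W) : Prop :=
  ∀ (a : X ⟶ Z) (b : Y ⟶ W), a ≫ m = e ≫ b → ∃! d : Y ⟶ Z, e ≫ d = a ∧ d ≫ m = b

/-- `(E, M)` is an (orthogonal) factorization system: every morphism factors as a morphism of `E`
followed by a morphism of `M`, and `E` and `M` determine each other by orthogonality. -/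
class IsFactorizationSystem (E M : MorphismProperty C) : Prop
    extends MorphismProperty.HasFactorization E M where
  left_iff {X Y : C} (e : X ⟶ Y) :
    E e ↔ ∀ ⦃Z W : C⦄ (m : Z ⟶ W), M m → Orthogonal e m
  right_iff {Z W : C} (m : Z ⟶ W) :
    M m ↔ ∀ ⦃X Y : C⦄ (e : X ⟶ Y), E e → Orthogonal e m

/-- The factorization system `(E, M)` is proper. -/
structure IsProper (E M : MorphismProperty C) : Prop where
  epi {X Y : C} (e : X ⟶ Y) : E e → Epi e
  mono {X Y : C} (m : X ⟶ Y) : M m → Mono m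

/-- `W` is closed under (small) `κ`-filtered colimits in the arrow category. -/
def IsClosedUnderFilteredColimits (W : MorphismProperty C) (κ : Cardinal.{w})
    [Fact κ.IsRegular] : Prop :=
  ∀ (J : Type w) [SmallCategory J] [IsCardinalFiltered J κ], W.IsStableUnderColimitsOfShape J

/-- Ordinary `κ`-pure morphisms. -/
def IsPure (κ : Cardinal.{w}) [Fact κ.IsRegular] {X Y : C} (f : X ⟶ Y) : Prop :=
  ∀ ⦃A B : C⦄, IsCardinalPresentable A κ → IsCardinalPresentable B κ →
    ∀ (g : A ⟶ B) (a : A ⟶ X) (b : B ⟶ Y), a ≫ f = g ≫ b → ∃ t : B ⟶ X, g ≫ t = a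

end FactorizationSystems

/-- The monoidal category `V` is locally `κ`-presentable as a closed category (to be used when `V`
is symmetric monoidal closed). -/
structure IsLocallyPresentableClosed (V : Type u) [Category.{w} V] [MonoidalCategory V]
    (κ : Cardinal.{w}) [Fact κ.IsRegular] : Prop where
  isCardinalLocallyPresentable : IsCardinalLocallyPresentable V κ
  unit : IsCardinalPresentable (𝟙_ V) κ
  tensor (X Y : V) : IsCardinalPresentable X κ → IsCardinalPresentable Y κ →
    IsCardinalPresentable (X ⊗ Y) κ

section Enriched

variable (V : Type u) [Category.{w} V] [MonoidalCategory V]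
variable {K : Type u'} [Category.{w} K] [EnrichedOrdinaryCategory V K]

/-- The cocone `c` is a conical colimit in the `V`-category `K`: for every `X`, the canonical cone
exhibits the hom-object `K(c.pt, X)` as the limit of `K(F -, X)` in `V`. -/
def IsConicalColimit {J : Type w} [SmallCategory J] {F : J ⥤ K} (c : Cocone F) : Prop :=
  ∀ X : K, Nonempty (IsLimit (((eHomFunctor V K).flip.obj X).mapCone c.op))

/-- `η : X ⟶ K(A, P)` exhibits `P` as the copower of `A` by `X`: for every `B`, the map
`K(P, B) ⟶ [X, K(A, B)]` that it induces, which is `V`-natural in `B`, is an isomorphism. -/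
def IsCopower [MonoidalClosed V] {X : V} {A P : K} (η : X ⟶ (A ⟶[V] P)) : Prop :=
  ∀ B : K, IsIso (MonoidalClosed.curry (η ▷ (P ⟶[V] B) ≫ eComp V A P B))

/-- The object `A` is `κ`-presentable in the enriched sense: `K(A, -) : K ⥤ V` preserves
`κ`-filtered conical colimits. -/
def IsEnrichedPresentable (κ : Cardinal.{w}) [Fact κ.IsRegular] (A : K) : Prop :=
  ∀ (J : Type w) [SmallCategory J] [IsCardinalFiltered J κ] (F : J ⥤ K) (c : Cocone F),
    IsConicalColimit V c → Nonempty (IsColimit ((eCoyoneda V A).mapCocone c))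

variable (K) in
/-- `K` is locally `κ`-presentable as a `V`-category. -/
structure IsLocallyPresentable [MonoidalClosed V] (κ : Cardinal.{w}) [Fact κ.IsRegular] :
    Prop where
  exists_conicalColimit (J : Type w) [SmallCategory J] (F : J ⥤ K) :
    ∃ c : Cocone F, IsConicalColimit V c
  exists_copower (X : V) (A : K) : ∃ (P : K) (η : X ⟶ (A ⟶[V] P)), IsCopower V η
  essentiallySmall :
    ObjectProperty.EssentiallySmall.{w} (IsEnrichedPresentable V κ : ObjectProperty K)
  exists_presentation (X : K) :
    ∃ (J : Type w) (_ : SmallCategory J) (_ : IsCardinalFiltered J κ) (F : J ⥤ K) (c : Cocone F),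
      IsConicalColimit V c ∧ (∀ j, IsEnrichedPresentable V κ (F.obj j)) ∧ c.pt = X

variable {V}
variable (E M : MorphismProperty V) [E.HasFactorization M]

/-- The `(E, M)`-factorization of the map `K(g, L) : K(B, L) ⟶ K(A, L)`, whose middle object is
denoted `P(g, L)`. -/
noncomputable def homFactorization {A B : K} (g : A ⟶ B) (L : K) :
    E.MapFactorizationData M (eHomWhiskerRight V g L) :=
  MorphismProperty.factorizationData E M (eHomWhiskerRight V g L)

variable [HasPullbacks V]

/-- The object `P(g, f)`: the pullback of `P(g, Y) ⟶ K(A, Y)` along `K(A, f)`. -/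
noncomputable abbrev purityObj {A B X Y : K} (g : A ⟶ B) (f : X ⟶ Y) : V :=
  pullback (eHomWhiskerLeft V A f) (homFactorization E M g Y).p

/-- The map `r : K(B, X) ⟶ P(g, f)` induced by `K(g, X)` and by `K(B, f)` followed by
`K(B, Y) ⟶ P(g, Y)`. -/
noncomputable def purityMap {A B X Y : K} (g : A ⟶ B) (f : X ⟶ Y) :
    (B ⟶[V] X) ⟶ purityObj E M g f :=
  pullback.lift (eHomWhiskerRight V g X) (eHomWhiskerLeft V B f ≫ (homFactorization E M g Y).i)
    (by rw [Category.assoc, (homFactorization E M g Y).fac, eHom_whisker_exchange])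

/-- `f` is `E`-pure with respect to `g`. -/
def IsEPureWrt {A B X Y : K} (g : A ⟶ B) (f : X ⟶ Y) : Prop :=
  E (purityMap E M g f)

/-- `f` is `(κ, E)`-pure. -/
def IsEPure (κ : Cardinal.{w}) [Fact κ.IsRegular] {X Y : K} (f : X ⟶ Y) : Prop :=
  ∀ ⦃A B : K⦄, IsEnrichedPresentable V κ A → IsEnrichedPresentable V κ B →
    ∀ g : A ⟶ B, IsEPureWrt E M g f

end Enriched

end EnrichedPurity

/-! Write `purityMap E M g f` as an `E`-map followed by an `M`-map p; it suffices that p is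
invertible. Since p is mono and the `κ`-presentable objects form a strong generator of `V`, it is
enough to lift through p every x : G ⟶ P(g, f) with G presentable. Present Y as a conical
`κ`-filtered colimit of presentables Fj. Closure of `M` under such colimits makes the component G ⟶
P(g, Y) of x come from some y : G ⟶ P(g, Fj) (`exists_lift_of_isColimit`). The copower of A by G is
presentable in the underlying category, so x and y transpose to a square to which ordinary purity
applies, giving t : Fj ⟶ X. Orthogonality turns K(B, t) and K(A, t) into a map from P(g, Fj) to the
domain of p; preceded by y, it lifts x. -/

namespace EnrichedPurity

/-! ### Orthogonality and filtered colimits of factorizations. -/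

section FactorizationSystems

variable {C : Type u} [Category.{w} C]

namespace Orthogonal

variable {X Y Z W : C} {e : X ⟶ Y} {m : Z ⟶ W}

/-- The diagonal filler of a commutative square. -/
noncomputable def lift (h : Orthogonal e m) (a : X ⟶ Z) (b : Y ⟶ W) (sq : a ≫ m = e ≫ b) :
    Y ⟶ Z :=
  (h a b sq).choose

lemma fac_left (h : Orthogonal e m) (a : X ⟶ Z) (b : Y ⟶ W) (sq : a ≫ m = e ≫ b) :
    e ≫ h.lift a b sq = a :=
  (h a b sq).choose_spec.1.1

lemma fac_left_assoc (h : Orthogonal e m) (a : X ⟶ Z) (b : Y ⟶ W) (sq : a ≫ m = e ≫ b)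
    {T : C} (k : Z ⟶ T) : e ≫ h.lift a b sq ≫ k = a ≫ k := by
  rw [← Category.assoc, h.fac_left]

lemma fac_right (h : Orthogonal e m) (a : X ⟶ Z) (b : Y ⟶ W) (sq : a ≫ m = e ≫ b) :
    h.lift a b sq ≫ m = b :=
  (h a b sq).choose_spec.1.2

lemma fac_right_assoc (h : Orthogonal e m) (a : X ⟶ Z) (b : Y ⟶ W) (sq : a ≫ m = e ≫ b)
    {T : C} (k : W ⟶ T) : h.lift a b sq ≫ m ≫ k = b ≫ k := by
  rw [← Category.assoc, h.fac_right]

lemma hom_ext (h : Orthogonal e m) {d d' : Y ⟶ Z} (h₁ : e ≫ d = e ≫ d') (h₂ : d ≫ m = d' ≫ m) :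
    d = d' :=
  (h (e ≫ d') (d' ≫ m) (by simp)).unique ⟨h₁, h₂⟩ ⟨rfl, rfl⟩

lemma comp_right {T : C} {n : W ⟶ T} (h : Orthogonal e m) (h' : Orthogonal e n) :
    Orthogonal e (m ≫ n) := fun a b sq ↦ by
  have sq' : (a ≫ m) ≫ n = e ≫ b := by simpa using sq
  have sq'' : a ≫ m = e ≫ h'.lift _ _ sq' := (h'.fac_left _ _ sq').symm
  refine ⟨h.lift _ _ sq'', ⟨h.fac_left _ _ _, ?_⟩, fun d hd ↦ ?_⟩
  · rw [h.fac_right_assoc, h'.fac_right]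
  · refine h.hom_ext ?_ (h'.hom_ext ?_ ?_)
    · rw [h.fac_left, hd.1]
    · rw [h.fac_right, h'.fac_left, ← Category.assoc, hd.1]
    · rw [h.fac_right, h'.fac_right, Category.assoc, hd.2]

lemma of_isPullback {Z' W' : C} {m' : Z' ⟶ W'} {t : Z' ⟶ Z} {b : W' ⟶ W}
    (h : Orthogonal e m) (sq : IsPullback t m' m b) : Orthogonal e m' := fun a c hac ↦ by
  have sq' : (a ≫ t) ≫ m = e ≫ c ≫ b := by
    rw [Category.assoc, sq.w, reassoc_of% hac]
  refine ⟨sq.lift (h.lift _ _ sq') c (h.fac_right _ _ _), ⟨?_, by simp⟩, fun d hd ↦ ?_⟩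
  · exact sq.hom_ext (by simp [h.fac_left]) (by simp [hac])
  · refine sq.hom_ext (h.hom_ext ?_ ?_) (by simp [hd.2])
    · simp [h.fac_left, reassoc_of% hd.1]
    · rw [Category.assoc, sq.w, reassoc_of% hd.2, Category.assoc, sq.w]
      simp

lemma comp_isIso_left {Y' : C} (h : Orthogonal e m) (i : Y ⟶ Y') [IsIso i] :
    Orthogonal (e ≫ i) m := fun a b sq ↦ by
  have sq' : a ≫ m = e ≫ i ≫ b := by simpa using sq
  refine ⟨inv i ≫ h.lift _ _ sq', ⟨by simp [h.fac_left], by simp [h.fac_right]⟩, fun d hd ↦ ?_⟩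
  rw [← cancel_epi i, IsIso.hom_inv_id_assoc]
  refine h.hom_ext ?_ ?_
  · rw [h.fac_left, ← hd.1, Category.assoc]
  · rw [h.fac_right, ← hd.2, Category.assoc]

end Orthogonal

namespace IsFactorizationSystem

variable {E M : MorphismProperty C} [IsFactorizationSystem E M]

lemma orthogonal {X Y Z W : C} {e : X ⟶ Y} {m : Z ⟶ W} (he : E e) (hm : M m) :
    Orthogonal e m :=
  (left_iff (M := M) e).1 he m hm

lemma right_comp (E : MorphismProperty C) [IsFactorizationSystem E M]
    {X Y Z : C} {m : X ⟶ Y} {n : Y ⟶ Z} (hm : M m) (hn : M n) :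
    M (m ≫ n) :=
  (right_iff (E := E) _).2 fun _ _ _ he ↦ (orthogonal he hm).comp_right (orthogonal he hn)

lemma right_of_isPullback (E : MorphismProperty C) [IsFactorizationSystem E M]
    {Z W Z' W' : C} {m : Z ⟶ W} {m' : Z' ⟶ W'} {t : Z' ⟶ Z} {b : W' ⟶ W}
    (hm : M m) (sq : IsPullback t m' m b) : M m' :=
  (right_iff (E := E) _).2 fun _ _ _ he ↦ (orthogonal he hm).of_isPullback sq

lemma left_comp_isIso (M : MorphismProperty C) [IsFactorizationSystem E M]
    {X Y Z : C} {e : X ⟶ Y} (he : E e) (i : Y ⟶ Z) [IsIso i] : E (e ≫ i) :=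
  (left_iff (M := M) _).2 fun _ _ _ hm ↦ (orthogonal he hm).comp_isIso_left i

/-- The functor sending `j` to the middle object of the factorization of `α.app j`. -/
@[simps]
noncomputable def middleFunctor {J : Type*} [Category J] {F G : J ⥤ C} {α : F ⟶ G}
    (φ : ∀ j, E.MapFactorizationData M (α.app j)) : J ⥤ C where
  obj j := (φ j).Z
  map {i j} u := (orthogonal (φ i).hi (φ j).hp).lift (F.map u ≫ (φ j).i) ((φ i).p ≫ G.map u)
    (by simp)
  map_id j := (orthogonal (φ j).hi (φ j).hp).hom_ext
    (by rw [Orthogonal.fac_left]; simp) (by rw [Orthogonal.fac_right]; simp)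
  map_comp {i j k} u v := (orthogonal (φ i).hi (φ k).hp).hom_ext
    (by rw [Orthogonal.fac_left, Orthogonal.fac_left_assoc, Category.assoc,
      Orthogonal.fac_left, F.map_comp, Category.assoc])
    (by rw [Orthogonal.fac_right, Category.assoc, Orthogonal.fac_right,
      Orthogonal.fac_right_assoc, G.map_comp, Category.assoc])

/-- The left parts of the factorizations, as a natural transformation. -/
@[simps]
noncomputable def toMiddleFunctor {J : Type*} [Category J] {F G : J ⥤ C} {α : F ⟶ G}
    (φ : ∀ j, E.MapFactorizationData M (α.app j)) : F ⟶ middleFunctor φ where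
  app j := (φ j).i
  naturality _ _ _ := (Orthogonal.fac_left _ _ _ _).symm

/-- The right parts of the factorizations, as a natural transformation. -/
@[simps]
noncomputable def fromMiddleFunctor {J : Type*} [Category J] {F G : J ⥤ C} {α : F ⟶ G}
    (φ : ∀ j, E.MapFactorizationData M (α.app j)) : middleFunctor φ ⟶ G where
  app j := (φ j).p
  naturality _ _ _ := Orthogonal.fac_right _ _ _ _

lemma toMiddleFunctor_comp_fromMiddleFunctor {J : Type*} [Category J] {F G : J ⥤ C} {α : F ⟶ G}
    (φ : ∀ j, E.MapFactorizationData M (α.app j)) (j : J) :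
    (toMiddleFunctor φ).app j ≫ (fromMiddleFunctor φ).app j = α.app j :=
  (φ j).fac

/-- Let `M` be closed under colimits of shape `J`, and let `e ≫ m` be the factorization of a colimit
of morphisms `α.app j`. A morphism to its middle object from an object that is presentable
relatively to colimits of shape `J` lifts, up to `m`, to the middle object of the factorization of
some `α.app j`. -/
lemma exists_lift_of_isColimit {J : Type w} [SmallCategory J] [HasColimitsOfShape J C]
    [M.IsStableUnderColimitsOfShape J] {F G : J ⥤ C} {α : F ⟶ G}
    (φ : ∀ j, E.MapFactorizationData M (α.app j)) {c : Cocone F} {d : Cocone G}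
    (hc : IsColimit c) (hd : IsColimit d) {β : c.pt ⟶ d.pt}
    (hβ : ∀ j, c.ι.app j ≫ β = α.app j ≫ d.ι.app j)
    (ψ : E.MapFactorizationData M β) {T : C}
    [PreservesColimitsOfShape J (coyoneda.obj (Opposite.op T))] (x : T ⟶ ψ.Z) :
    ∃ (j : J) (y : T ⟶ (φ j).Z), y ≫ (φ j).p ≫ d.ι.app j = x ≫ ψ.p := by
  -- Only the right part `m` of the colimit factorization has to lie in its class: a comparison map
  -- from `ψ.Z` to the colimit is enough, and no inverse is used.
  let P := colimit.cocone (middleFunctor φ)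
  have hP : IsColimit P := colimit.isColimit _
  let m : P.pt ⟶ d.pt := hP.map d (fromMiddleFunctor φ)
  have hm (j : J) : P.ι.app j ≫ m = (fromMiddleFunctor φ).app j ≫ d.ι.app j := hP.ι_map _ _ j
  let e : c.pt ⟶ P.pt := hc.map P (toMiddleFunctor φ)
  have he (j : J) : c.ι.app j ≫ e = (toMiddleFunctor φ).app j ≫ P.ι.app j := hc.ι_map _ _ j
  have hmM : M m := MorphismProperty.IsStableUnderColimitsOfShape.condition _ _ _ _ hP hd
    (fromMiddleFunctor φ) (fun j ↦ (φ j).hp) m hm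
  have sq : e ≫ m = ψ.i ≫ ψ.p := hc.hom_ext fun j ↦ by
    rw [reassoc_of% (he j), hm, ψ.fac, hβ,
      reassoc_of% (toMiddleFunctor_comp_fromMiddleFunctor φ j)]
  let δ := (orthogonal ψ.hi hmM).lift _ _ sq
  obtain ⟨j, y, hy⟩ := exists_hom_of_preservesColimit_coyoneda hP (x ≫ δ)
  have : y ≫ (fromMiddleFunctor φ).app j ≫ d.ι.app j = x ≫ ψ.p := by
    rw [← hm, reassoc_of% hy, Orthogonal.fac_right]
  exact ⟨j, y, this⟩

end IsFactorizationSystem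

end FactorizationSystems

/-! ### Conical colimits, presentability and copowers in the underlying category. -/

section Enriched

variable (V : Type u) [Category.{w} V] [MonoidalCategory V]
variable {K : Type u'} [Category.{w} K] [EnrichedOrdinaryCategory V K]

lemma eHomEquiv_whiskerLeft {A B C : K} (f : A ⟶ B) (g : B ⟶ C) :
    eHomEquiv V f ≫ eHomWhiskerLeft V A g = eHomEquiv V (f ≫ g) := by
  rw [eHomEquiv_comp, MonoidalCategory.tensorHom_def, eHomWhiskerLeft,
    rightUnitor_inv_naturality_assoc, unitors_inv_equal, Category.assoc]

lemma eHomEquiv_whiskerRight {A B C : K} (f : A ⟶ B) (g : B ⟶ C) :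
    eHomEquiv V g ≫ eHomWhiskerRight V f C = eHomEquiv V (f ≫ g) := by
  rw [eHomEquiv_comp, MonoidalCategory.tensorHom_def', eHomWhiskerRight,
    leftUnitor_inv_naturality_assoc, Category.assoc]

variable {V}

/-- A conical colimit is a colimit in the underlying category. -/
lemma IsConicalColimit.nonempty_isColimit {J : Type w} [SmallCategory J] {F : J ⥤ K}
    {c : Cocone F} (hc : IsConicalColimit V c) : Nonempty (IsColimit c) := by
  -- A cocone in the underlying category is a cone of hom-objects with apex the unit.
  let S (s : Cocone F) : Cone (F.op ⋙ (eHomFunctor V K).flip.obj s.pt) :=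
    { pt := 𝟙_ V
      π :=
        { app j := eHomEquiv V (s.ι.app j.unop)
          naturality i j u := by
            refine (Category.id_comp _).trans (Eq.symm ?_)
            refine (eHomEquiv_whiskerRight V (F.map u.unop) (s.ι.app i.unop)).trans ?_
            rw [s.w] } }
  have uniq {T : K} {h h' : c.pt ⟶ T} (w : ∀ j, c.ι.app j ≫ h = c.ι.app j ≫ h') : h = h' := by
    refine (eHomEquiv V).injective ((hc T).some.hom_ext fun j ↦ ?_)
    have := congrArg (eHomEquiv V) (w j.unop)
    rwa [← eHomEquiv_whiskerRight, ← eHomEquiv_whiskerRight] at this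
  have fac (s : Cocone F) (j : J) :
      c.ι.app j ≫ (eHomEquiv V).symm ((hc s.pt).some.lift (S s)) = s.ι.app j := by
    refine (eHomEquiv V).injective ?_
    rw [← eHomEquiv_whiskerRight]
    refine (congrArg (· ≫ _) ((eHomEquiv V).apply_symm_apply _)).trans ?_
    exact (hc s.pt).some.fac (S s) (Opposite.op j)
  exact ⟨{
    desc s := (eHomEquiv V).symm ((hc s.pt).some.lift (S s))
    fac := fac
    uniq s m hm := uniq fun j ↦ by rw [hm, fac] }⟩

/-- Each diagram has a conical colimit, which is also its ordinary colimit, so preserving that one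
cocone suffices. -/
lemma IsEnrichedPresentable.isCardinalAccessible_eCoyoneda {κ : Cardinal.{w}} [Fact κ.IsRegular]
    (hK : ∀ (J : Type w) [SmallCategory J] (F : J ⥤ K), ∃ c : Cocone F, IsConicalColimit V c)
    {A : K} (hA : IsEnrichedPresentable V κ A) : (eCoyoneda V A).IsCardinalAccessible κ where
  preservesColimitOfShape J _ _ :=
    { preservesColimit {F} := by
        obtain ⟨c, hc⟩ := hK J F
        exact preservesColimit_of_preserves_colimit_cocone hc.nonempty_isColimit.some
          (hA J F c hc).some }

/-- An object `P` representing `B ↦ (G ⟶ K(A, B))` is presentable in the underlying category if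
`G` is presentable and `K(A, -)` is accessible. -/
lemma isCardinalPresentable_of_bijective (κ : Cardinal.{w}) [Fact κ.IsRegular] {A P : K} {G : V}
    [(eCoyoneda V A).IsCardinalAccessible κ] [IsCardinalPresentable G κ] (η : G ⟶ (A ⟶[V] P))
    (hη : ∀ B : K, Function.Bijective fun h : P ⟶ B ↦ η ≫ eHomWhiskerLeft V A h) :
    IsCardinalPresentable P κ := by
  let e : eCoyoneda V A ⋙ coyoneda.obj (Opposite.op G) ≅ coyoneda.obj (Opposite.op P) :=
    (NatIso.ofComponents (fun B ↦ (Equiv.ofBijective _ (hη B)).toIso) (fun {B B'} u ↦ by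
      ext h
      change η ≫ eHomWhiskerLeft V A (h ≫ u) =
        (η ≫ eHomWhiskerLeft V A h) ≫ eHomWhiskerLeft V A u
      rw [eHomWhiskerLeft_comp, Category.assoc])).symm
  exact Functor.isCardinalAccessible_of_natIso e κ

/-- The case of the unit: `A` represents `B ↦ (𝟙_ V ⟶ K(A, B))`. -/
lemma IsEnrichedPresentable.isCardinalPresentable {κ : Cardinal.{w}} [Fact κ.IsRegular]
    (hK : ∀ (J : Type w) [SmallCategory J] (F : J ⥤ K), ∃ c : Cocone F, IsConicalColimit V c)
    [IsCardinalPresentable (𝟙_ V) κ] {A : K} (hA : IsEnrichedPresentable V κ A) :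
    IsCardinalPresentable A κ := by
  have := hA.isCardinalAccessible_eCoyoneda hK
  refine isCardinalPresentable_of_bijective (A := A) κ (eHomEquiv V (𝟙 A)) fun B ↦ ?_
  convert (eHomEquiv V (X := A) (Y := B)).bijective using 2 with h
  rw [eHomEquiv_whiskerLeft, Category.id_comp]

/-- The universal property of a copower in the underlying category. -/
lemma IsCopower.bijective [MonoidalClosed V] {G : V} {A P : K} {η : G ⟶ (A ⟶[V] P)}
    (hη : IsCopower V η) (B : K) :
    Function.Bijective fun h : P ⟶ B ↦ η ≫ eHomWhiskerLeft V A h := by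
  have := hη B
  -- Through I ⟶ K(P, B), I ⟶ [G, K(A, B)] and G ⊗ I ⟶ K(A, B), where I is the unit.
  let e : (P ⟶ B) ≃ (G ⟶ (A ⟶[V] B)) :=
    (((eHomEquiv V).trans (asIso (MonoidalClosed.curry
      (η ▷ (P ⟶[V] B) ≫ eComp V A P B))).homToEquiv).trans
        ((ihom.adjunction G).homEquiv _ _).symm).trans (ρ_ G).homFromEquiv
  have he (h : P ⟶ B) : e h = η ≫ eHomWhiskerLeft V A h := by
    change (ρ_ G).inv ≫ MonoidalClosed.uncurry (eHomEquiv V h ≫ MonoidalClosed.curry _) = _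
    rw [MonoidalClosed.uncurry_natural_left, MonoidalClosed.uncurry_curry, whisker_exchange_assoc,
      eHomWhiskerLeft, rightUnitor_inv_naturality_assoc]
  convert e.bijective using 2 with h
  exact (he h).symm

end Enriched

end EnrichedPurity

/-! ### The main theorem. -/

open EnrichedPurity in
theorem mainTheorem11
    {V : Type u} [Category.{w} V] [MonoidalCategory V] [SymmetricCategory V] [MonoidalClosed V]
    [HasLimits V] [HasColimits V]
    (κ : Cardinal.{w}) [Fact κ.IsRegular]
    (hV : EnrichedPurity.IsLocallyPresentableClosed V κ)
    (E M : MorphismProperty V) [EnrichedPurity.IsFactorizationSystem E M]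
    (hproper : EnrichedPurity.IsProper E M)
    (hM : EnrichedPurity.IsClosedUnderFilteredColimits M κ)
    {K : Type u'} [Category.{w} K] [EnrichedOrdinaryCategory V K]
    (hK : EnrichedPurity.IsLocallyPresentable V K κ)
    {X Y : K} (f : X ⟶ Y) (hf : EnrichedPurity.IsPure κ f) :
    EnrichedPurity.IsEPure E M κ f := by
  have := hV.isCardinalLocallyPresentable
  have := hV.unit
  intro A B hA hB g
  have := hA.isCardinalAccessible_eCoyoneda hK.exists_conicalColimit
  let φ := MorphismProperty.factorizationData E M (purityMap E M g f)
  suffices IsIso φ.p by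
    have hφ := IsFactorizationSystem.left_comp_isIso M φ.hi φ.p
    rwa [φ.fac] at hφ
  have hfst : M (pullback.fst (eHomWhiskerLeft V A f) (homFactorization E M g Y).p) :=
    IsFactorizationSystem.right_of_isPullback E (homFactorization E M g Y).hp
      (IsPullback.of_hasPullback _ _).flip
  have hm := IsFactorizationSystem.right_comp E φ.hp hfst
  have := hproper.mono _ hfst
  have := hproper.mono _ φ.hp
  obtain ⟨P, _, hP⟩ := HasCardinalFilteredGenerator.exists_generator V κ
  refine hP.isStrongGenerator.isIso_of_mono φ.p fun G hG x ↦ ?_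
  have : IsCardinalPresentable G κ := hP.le_isCardinalPresentable _ hG
  obtain ⟨J, _, _, F, c, hc, hF, rfl⟩ := hK.exists_presentation Y
  have := hM J
  have := preservesColimitsOfShape_of_isCardinalPresentable G κ J
  let α : F ⋙ eCoyoneda V B ⟶ F ⋙ eCoyoneda V A :=
    Functor.whiskerLeft F ((eHomFunctor V K).map g.op)
  obtain ⟨j, y, hy⟩ : ∃ (j : J) (y : G ⟶ (homFactorization E M g (F.obj j)).Z),
      y ≫ (homFactorization E M g (F.obj j)).p ≫ eHomWhiskerLeft V A (c.ι.app j) =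
        (x ≫ pullback.snd _ _) ≫ (homFactorization E M g c.pt).p :=
    IsFactorizationSystem.exists_lift_of_isColimit (α := α)
      (fun j ↦ homFactorization E M g (F.obj j)) (hB J F c hc).some (hA J F c hc).some
      (fun j ↦ eHom_whisker_exchange V g (c.ι.app j)) _ _
  obtain ⟨Q, η, hη⟩ := hK.exists_copower G A
  obtain ⟨a, ha⟩ := (hη.bijective X).2 (x ≫ pullback.fst _ _)
  obtain ⟨b, hb⟩ := (hη.bijective (F.obj j)).2 (y ≫ (homFactorization E M g (F.obj j)).p)
  obtain ⟨t, ht⟩ := hf (isCardinalPresentable_of_bijective κ η hη.bijective)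
    ((hF j).isCardinalPresentable hK.exists_conicalColimit) b a (c.ι.app j) (by
      -- Both composites transpose to the map G ⟶ K(A, Y) underlying `x`, by the pullback square and
      -- the choice of `y`.
      apply (hη.bijective c.pt).1
      dsimp only at ha hb ⊢
      rw [eHomWhiskerLeft_comp, eHomWhiskerLeft_comp, reassoc_of% ha, reassoc_of% hb,
        pullback.condition]
      simpa using hy.symm)
  -- The target `φ.p ≫ pullback.fst` is in `M`, as the first projection is a pullback of an `M`-map;
  -- hence the square has a diagonal.
  have sq : (eHomWhiskerLeft V B t ≫ φ.i) ≫
      φ.p ≫ pullback.fst (eHomWhiskerLeft V A f) (homFactorization E M g c.pt).p =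
      (homFactorization E M g (F.obj j)).i ≫ (homFactorization E M g (F.obj j)).p ≫
        eHomWhiskerLeft V A t := by
    rw [Category.assoc, φ.fac_assoc, purityMap, pullback.lift_fst,
      MorphismProperty.MapFactorizationData.fac_assoc, eHom_whisker_exchange]
  refine ⟨y ≫
    (IsFactorizationSystem.orthogonal (homFactorization E M g (F.obj j)).hi hm).lift _ _ sq, ?_⟩
  dsimp only
  -- The first projection is mono, so only K(A, X)-components need comparing; there `b ≫ t = a`
  -- gives the equality.
  rw [← cancel_mono (pullback.fst (eHomWhiskerLeft V A f) (homFactorization E M g c.pt).p),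
    Category.assoc, Category.assoc, Orthogonal.fac_right]
  dsimp only at ha hb
  rw [← ha, ← ht, eHomWhiskerLeft_comp, reassoc_of% hb]
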